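/- For $\eta\ge 0$ consider the system $\partial_t U+\partial_x[F_\eta(U)]=0$, $U=(u,v,w)\in\mathbb R^3$, with flux $$F_\eta(U)=\begin{pmatrix}4[(v-1)u-w]+\eta\,(2uw-2u^2(v-1))\\ v^2\\ 4\{v(v-2)u-(v-1)w\}+\eta\,(w^2-u^2(v-2)v)\end{pmatrix},$$ for states in the unit ball $|U|<1$. Let $\lambda_1(U)<\lambda_2(U)<\lambda_3(U)$ be the eigenvalues of $DF_\eta(U)$, and let $\vec r_1,\vec r_2,\vec r_3$ be the eigenvectors normalized so that the first component of $\vec r_1$, the second component of $\vec r_2$ and the first component of $\vec r_3$ equal $1$. The $i$-rarefaction curve $R_i[s,\bar U]$ is the integral curve of $\vec r_i$ with $R_i[0,\bar U]=\bar U$. The $i$-Hugoniot locus $S_i[s,\bar U]$ is the continuous curve in the unit ball with $S_i[0,\bar U]=\bar U$ along which the Rankine–Hugoniot conditions $F_\eta(S_i[s,\bar U])-F_\eta(\bar U)=\gamma(s)\,(S_i[s,\bar U]-\bar U)$ hold with a continuous speed $\gamma$ such that $\gamma(0)=\lambda_i(\bar U)$, parametrized so that the first ($i=1,3$), respectively second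 ($i=2$), component of $S_i[s,\bar U]$ is that of $\bar U$ plus $s$. The wave fan curves are $D_i[s,\bar U]=S_i[s,\bar U]$ if $s<0$ and $D_i[s,\bar U]=R_i[s,\bar U]$ if $s\ge0$, for $i=1,2$, and $D_3[s,\bar U]=S_3[s,\bar U]$ if $s>0$ and $D_3[s,\bar U]=R_3[s,\bar U]$ if $s\le 0$. There is a constant $\varepsilon>0$ such that the following holds for every $0<a<1/2$, with $U_\sharp=(a,0,-a)$. Assume $$|U_\ell-U_\sharp|\le\varepsilon a,\qquad 0\le\eta\le\varepsilon a,\qquad s_1,s_2\in[-\varepsilon a,0).$$ Then $D_2[s_2,D_2[s_1,U_\ell]]$ exists, and if $U_r=D_2\big[s_2,D_2[s_1,U_\ell]\big]$, then there are $\sigma<0$ and $\tau>0$ such that $$U_r=D_3\Big[\tau,D_2\big[s_1+s_2,D_1[\sigma,U_\ell]\big]\Big].$$ Moreover, with $U'=D_1[\sigma,U_\ell]$ and $U''=D_2[s_1+s_2,U']$, the pairs $(U_\ell,U')$, $(U',U'')$, $(U'',U_r)$ are the left and right states of a 1-shock, a 2-shock and a 3-shock, respectively, that satisfy the Lax admissibility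 criterion $\lambda_i(U^+)\le\gamma\le\lambda_i(U^-)$, where $\gamma$ is the speed of the shock, $U^-\neq U^+$ are its left and right states and $i$ is its family (for $\eta=0$ the 1- and the 3-shock are contact discontinuities). -/

import Mathlib

namespace BaitiJenssen

/-- States `U = (u, v, w)` of the system, with the Euclidean norm. -/
abbrev State : Type := EuclideanSpace ℝ (Fin 3)

/-- The flux `F_η` of the Baiti-Jenssen system `∂ₜ U + ∂ₓ [F_η(U)] = 0`, where
`p₁(U) = 2uw - 2u²(v-1)` and `p₃(U) = w² - u²(v-2)v`. -/
noncomputable def flux (η : ℝ) (U : State) : State :=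
  !₂[4 * ((U 1 - 1) * U 0 - U 2) + η * (2 * U 0 * U 2 - 2 * U 0 ^ 2 * (U 1 - 1)),
    U 1 ^ 2,
    4 * (U 1 * (U 1 - 2) * U 0 - (U 1 - 1) * U 2)
      + η * (U 2 ^ 2 - U 0 ^ 2 * (U 1 - 2) * U 1)]

/-- The Jacobian `DF_η(U)` as an endomorphism of the state space. -/
noncomputable def jacobian (η : ℝ) (U : State) : Module.End ℝ State :=
  (fderiv ℝ (flux η) U).toLinearMap

/-- `lam 0 < lam 1 < lam 2` are the three eigenvalues `λ₁(U) < λ₂(U) < λ₃(U)` of `DF_η(U)`.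
Families are indexed from `0`: the `i`-th family below is family `i + 1` in the usual count. -/
def IsCharSpeeds (η : ℝ) (U : State) (lam : Fin 3 → ℝ) : Prop :=
  StrictMono lam ∧ ∀ i, (jacobian η U).HasEigenvalue (lam i)

/-- The coordinate used as parameter along the wave curves of each family: the
eigenvectors are normalized to be `(1, *, *)`, `(*, 1, *)` and `(1, *, *)`, respectively. -/
def paramCoord : Fin 3 → Fin 3 := ![0, 1, 0]

/-- Rankine-Hugoniot conditions for a jump from `U` to `V` that travels with speed `γ`. -/
def RankineHugoniot (η : ℝ) (U V : State) (γ : ℝ) : Prop :=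
  flux η V - flux η U = γ • (V - U)

/-- `V` is the point with parameter `s` on the integral curve through `U` of the normalized
eigenvector field of the `i`-th family, inside the unit ball (where the system is strictly
hyperbolic). -/
def OnRarefactionCurve (η : ℝ) (i : Fin 3) (s : ℝ) (U V : State) : Prop :=
  ∃ R : ℝ → State, R 0 = U ∧ R s = V ∧
    ∀ t ∈ Set.uIcc 0 s, ‖R t‖ < 1 ∧
      ∃ lam r, IsCharSpeeds η (R t) lam ∧ (jacobian η (R t)).HasEigenvector (lam i) r ∧
        r (paramCoord i) = 1 ∧ HasDerivWithinAt R r (Set.uIcc 0 s) t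

/-- `V` is the point with parameter `s` on the `i`-th Hugoniot locus of `U`: it is reached from
`U` along a continuous curve, inside the unit ball, of states connected to `U` by a jump
whose speed starts from `λᵢ(U)` and varies continuously. -/
def OnHugoniotCurve (η : ℝ) (i : Fin 3) (s : ℝ) (U V : State) : Prop :=
  ∃ (S : ℝ → State) (γ : ℝ → ℝ),
    ContinuousOn S (Set.uIcc 0 s) ∧ ContinuousOn γ (Set.uIcc 0 s) ∧ S 0 = U ∧ S s = V ∧
    (∃ lam, IsCharSpeeds η U lam ∧ γ 0 = lam i) ∧
    ∀ t ∈ Set.uIcc 0 s, ‖S t‖ < 1 ∧ RankineHugoniot η U (S t) (γ t) ∧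
      S t (paramCoord i) = U (paramCoord i) + t

/-- `s` is a shock parameter: the first two families have shocks for negative parameters,
the third one for positive parameters. -/
def IsShockParam (i : Fin 3) (s : ℝ) : Prop :=
  if i = 2 then 0 < s else s < 0

/-- `V = D[s, U]`, where `D` is the wave fan curve of the `i`-th family: the Hugoniot locus for
shock parameters and the rarefaction curve otherwise. -/
def IsWaveFan (η : ℝ) (i : Fin 3) (s : ℝ) (U V : State) : Prop :=
  (IsShockParam i s ∧ OnHugoniotCurve η i s U V) ∨
    (¬ IsShockParam i s ∧ OnRarefactionCurve η i s U V)

/-- `U` (on the left) and `V` (on the right) are connected by a Lax admissible shock of the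
`i`-th family. The inequalities are weak, so that contact discontinuities, which replace the
shocks of the first and third family when `η = 0`, are included. -/
def IsLaxShock (η : ℝ) (i : Fin 3) (U V : State) : Prop :=
  U ≠ V ∧ ∃ γ lam lam', RankineHugoniot η U V γ ∧ IsCharSpeeds η U lam ∧ IsCharSpeeds η V lam' ∧
    lam' i ≤ γ ∧ γ ≤ lam i

end BaitiJenssen

namespace BaitiJenssen

/-! For fixed `v` the vectors `(1, v)` and `(1, v - 2)` are the first and third eigenvectors. In the
coordinates `A`, `B` along them, waves of families 1 and 3 move along straight lines that change
only `A` or only `B`, with scalar fluxes `-4A + 2ηA²` and `4B - 2ηB²`. The second component obeys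
`v_t + (v²)_x = 0`, so a 2-jump of size `s` has speed `2v + s`, and its Rankine-Hugoniot conditions
become two scalar quadratic equations (`rankineHugoniot_two_iff`).

Let 2-jumps of sizes `s₁`, `s₂` join `U₀`, `U₁`, `U₂`. A direct jump from `U₀` to `U₂` would have
speed `2v + s₁ + s₂`, and it violates Rankine-Hugoniot by the defect `(s₁ + s₂)U₁ - s₂U₀ - s₁U₂`.
This is `-s₁s₂` times the difference of the two chord slopes at `U₁`. Each slope is about `-γ(A +
B)/8` up to a common term, where `γ` is the jump speed. As `A + B ≈ a > 0` and the second jump is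
slower by `-(s₁ + s₂)`, the slopes differ by about `-(s₁ + s₂)a/8 > 0` in both coordinates, so the
defect is negative in both (`two_jumps_defect`).

The scalar fluxes are decreasing in the moving frame. Hence the defect is repaired by lowering `A`
on the left and raising `B` on the right (`exists_interaction`). Since `λ₁` increases with `A` and
`λ₃` decreases with `B`, these corrections are a 1-shock and a 3-shock. -/

/-! ### Wave coordinates and the eigenstructure -/

/-- The state with second component `v` whose first and third components are
`A • (1, v) + B • (1, v - 2)`: for frozen `v` the flux decouples in `A` and `B`. -/
noncomputable def ofWaveCoords (A B v : ℝ) : State :=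
  !₂[A + B, v, v * A + (v - 2) * B]

@[simp] lemma ofWaveCoords_zero (A B v : ℝ) : ofWaveCoords A B v 0 = A + B := rfl

@[simp] lemma ofWaveCoords_one (A B v : ℝ) : ofWaveCoords A B v 1 = v := rfl

@[simp] lemma ofWaveCoords_two (A B v : ℝ) : ofWaveCoords A B v 2 = v * A + (v - 2) * B := rfl

lemma eq_ofWaveCoords (U : State) :
    U = ofWaveCoords ((U 2 - (U 1 - 2) * U 0) / 2) ((U 1 * U 0 - U 2) / 2) (U 1) := by
  ext i
  fin_cases i <;> simp <;> ring

lemma norm_lt_one_iff (U : State) : ‖U‖ < 1 ↔ U 0 ^ 2 + U 1 ^ 2 + U 2 ^ 2 < 1 := by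
  rw [← sq_lt_one_iff₀ (norm_nonneg U), EuclideanSpace.real_norm_sq_eq, Fin.sum_univ_three]

lemma differentiable_flux (η : ℝ) : Differentiable ℝ (flux η) := by
  rw [differentiable_euclidean]
  intro i
  fin_cases i <;> simp [flux] <;> fun_prop

lemma jacobian_apply (η A B v x y z : ℝ) :
    jacobian η (ofWaveCoords A B v) !₂[x + y, z, v * x + (v - 2) * y] =
      !₂[(-4 + 4 * η * A) * x + (4 - 4 * η * B) * y
          + z * (4 * (A + B) - 2 * η * (A + B) ^ 2),
        2 * v * z,
        v * ((-4 + 4 * η * A) * x) + (v - 2) * ((4 - 4 * η * B) * y)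
          + z * (4 * ((2 * v - 2) * (A + B) - (v * A + (v - 2) * B))
            - η * (2 * v - 2) * (A + B) ^ 2)] := by
  set r : State := !₂[x + y, z, v * x + (v - 2) * y] with hr
  have h1 : HasDerivAt (fun t : ℝ => ofWaveCoords A B v + t • r) r 0 := by
    simpa using ((hasDerivAt_id (0 : ℝ)).smul_const r).const_add (ofWaveCoords A B v)
  have h2 : HasFDerivAt (flux η) (fderiv ℝ (flux η) (ofWaveCoords A B v))
      (ofWaveCoords A B v + (0 : ℝ) • r) := by
    simpa using (differentiable_flux η (ofWaveCoords A B v)).hasFDerivAt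
  have h3 := h2.comp_hasDerivAt (0 : ℝ) h1
  have h4 : ∀ i, HasDerivAt (fun t : ℝ => flux η (ofWaveCoords A B v + t • r) i)
      (jacobian η (ofWaveCoords A B v) r i) 0 := fun i =>
    (EuclideanSpace.proj (𝕜 := ℝ) i).hasFDerivAt.comp_hasDerivAt (0 : ℝ) h3
  have hlin : ∀ c d : ℝ, HasDerivAt (fun t : ℝ => c + t * d) d 0 := fun c d => by
    simpa using ((hasDerivAt_id (0 : ℝ)).mul_const d).const_add c
  have hu := hlin (A + B) (x + y)
  have hv := hlin v z
  have hw := hlin (v * A + (v - 2) * B) (v * x + (v - 2) * y)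
  ext i
  refine (h4 i).unique ?_
  fin_cases i
  · refine ((((hv.sub_const 1).mul hu).sub hw).const_mul 4 |>.add
      ((((hu.const_mul 2).mul hw).sub
        (((hu.pow 2).const_mul 2).mul (hv.sub_const 1))).const_mul η)).congr_deriv ?_
    simp
    ring
  · refine (hv.pow 2).congr_deriv ?_
    simp
  · refine (((((hv.mul (hv.sub_const 2)).mul hu).sub
      ((hv.sub_const 1).mul hw)).const_mul 4).add
      (((hw.pow 2).sub (((hu.pow 2).mul (hv.sub_const 2)).mul hv)).const_mul η)).congr_deriv ?_
    simp
    ring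

/-- The eigenvalues of the Jacobian in wave coordinates. -/
noncomputable def charSpeeds (η A B v : ℝ) : Fin 3 → ℝ :=
  ![-4 + 4 * η * A, 2 * v, 4 - 4 * η * B]

lemma isCharSpeeds_ofWaveCoords {η A B v : ℝ} (h₁ : -4 + 4 * η * A < 2 * v)
    (h₂ : 2 * v < 4 - 4 * η * B) : IsCharSpeeds η (ofWaveCoords A B v) (charSpeeds η A B v) := by
  constructor
  · rw [Fin.strictMono_iff_lt_succ]
    intro i
    fin_cases i
    · simpa [charSpeeds] using h₁
    · simpa [charSpeeds] using h₂
  · intro i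
    fin_cases i
    · refine Module.End.hasEigenvalue_of_hasEigenvector (x := !₂[1 + 0, 0, v * 1 + (v - 2) * 0])
        (Module.End.hasEigenvector_iff.2 ⟨Module.End.mem_eigenspace_iff.2 ?_, fun h => ?_⟩)
      · rw [jacobian_apply]
        ext j
        fin_cases j <;> simp [charSpeeds]
        ring
      · simpa using congrArg (fun W : State => W 0) h
    · have e₁ : 2 * v - (-4 + 4 * η * A) ≠ 0 := by linarith
      have e₂ : 2 * v - (4 - 4 * η * B) ≠ 0 := by linarith
      -- The source `(c, d)` splits along `(1, v)` and `(1, v - 2)` with coefficients `c - (v * c -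
      -- d) / 2` and `(v * c - d) / 2`; `x` and `y` then solve decoupled equations.
      set c := 4 * (A + B) - 2 * η * (A + B) ^ 2 with hc
      set d := 4 * ((2 * v - 2) * (A + B) - (v * A + (v - 2) * B))
        - η * (2 * v - 2) * (A + B) ^ 2 with hd
      set x := (c - (v * c - d) / 2) / (2 * v - (-4 + 4 * η * A)) with hx
      set y := (v * c - d) / 2 / (2 * v - (4 - 4 * η * B)) with hy
      have hx' : x * (2 * v - (-4 + 4 * η * A)) = c - (v * c - d) / 2 := div_mul_cancel₀ _ e₁
      have hy' : y * (2 * v - (4 - 4 * η * B)) = (v * c - d) / 2 := div_mul_cancel₀ _ e₂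
      refine Module.End.hasEigenvalue_of_hasEigenvector (x := !₂[x + y, 1, v * x + (v - 2) * y])
        (Module.End.hasEigenvector_iff.2 ⟨Module.End.mem_eigenspace_iff.2 ?_, fun h => ?_⟩)
      · rw [jacobian_apply]
        ext j
        fin_cases j <;> simp [charSpeeds]
        · linear_combination -hx' - hy'
        · linear_combination -v * hx' - (v - 2) * hy'
      · simpa using congrArg (fun W : State => W 1) h
    · refine Module.End.hasEigenvalue_of_hasEigenvector (x := !₂[0 + 1, 0, v * 0 + (v - 2) * 1])
        (Module.End.hasEigenvector_iff.2 ⟨Module.End.mem_eigenspace_iff.2 ?_, fun h => ?_⟩)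
      · rw [jacobian_apply]
        ext j
        fin_cases j <;> simp [charSpeeds]
        ring
      · simpa using congrArg (fun W : State => W 0) h

/-! ### Rankine-Hugoniot conditions in wave coordinates -/

/-- The flux of the scalar laws that govern the coordinates `A` (with `b = 4 + γ`) and, up to
sign, `B` (with `b = 4 - γ`) for frozen `v`, in a frame that moves with speed `γ`. -/
noncomputable def scalarFlux (η b x : ℝ) : ℝ := 2 * η * x ^ 2 - b * x

/-- The Rankine-Hugoniot conditions, in wave coordinates, for a jump of the second family from
`(A, B, v)` to `(A', B', v + s)`. -/
def IsTwoJump (η v s A B A' B' : ℝ) : Prop :=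
  scalarFlux η (4 + (2 * v + s)) A' = (1 - s / 2) * scalarFlux η (4 + (2 * v + s)) A
      + s / 2 * scalarFlux η (4 - (2 * v + s)) B ∧
    scalarFlux η (4 - (2 * v + s)) B' = (1 + s / 2) * scalarFlux η (4 - (2 * v + s)) B
      - s / 2 * scalarFlux η (4 + (2 * v + s)) A

lemma rankineHugoniot_iff (η γ : ℝ) (U V : State) :
    RankineHugoniot η U V γ ↔ ∀ i, flux η V i - flux η U i = γ * (V i - U i) := by
  rw [RankineHugoniot]
  exact ⟨fun h i => congrArg (fun W : State => W i) h, fun h => by ext i; exact h i⟩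

/-- The flux relative to the jump is continuous, and its coefficients are re-expanded in the basis
at `v + s` through `(1, v) = (1 - s/2)(1, v + s) + (s/2)(1, v + s - 2)` and the analogue for `(1, v
- 2)`. -/
lemma rankineHugoniot_two_iff (η v s A B A' B' : ℝ) :
    RankineHugoniot η (ofWaveCoords A B v) (ofWaveCoords A' B' (v + s)) (2 * v + s) ↔
      IsTwoJump η v s A B A' B' := by
  rw [rankineHugoniot_iff, Fin.forall_fin_succ, Fin.forall_fin_two]
  simp only [flux, IsTwoJump, scalarFlux, Fin.isValue, Fin.succ_zero_eq_one, Fin.succ_one_eq_two]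
  simp only [Matrix.cons_val, ofWaveCoords_zero, ofWaveCoords_one, ofWaveCoords_two]
  constructor
  · rintro ⟨h₀, -, h₂⟩
    constructor
    · linear_combination (h₂ - (v + s - 2) * h₀) / 2
    · linear_combination (h₂ - (v + s) * h₀) / 2
  · rintro ⟨h₁, h₂⟩
    refine ⟨?_, by ring, ?_⟩
    · linear_combination h₁ - h₂
    · linear_combination (v + s) * h₁ - (v + s - 2) * h₂

lemma speed_eq_of_rankineHugoniot {η γ s : ℝ} {U V : State} (hs : s ≠ 0)
    (h : RankineHugoniot η U V γ) (hV : V 1 = U 1 + s) : γ = 2 * U 1 + s := by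
  have h₁ := (rankineHugoniot_iff η γ U V).1 h 1
  simp only [flux, PiLp.toLp_apply, Matrix.cons_val, hV] at h₁
  apply mul_right_cancel₀ hs
  linear_combination -h₁

lemma IsTwoJump.symm {η v s A B A' B' : ℝ} (h : IsTwoJump η v s A B A' B') :
    IsTwoJump η (v + s) (-s) A' B' A B := by
  obtain ⟨h₁, h₂⟩ := h
  have e : 2 * (v + s) + -s = 2 * v + s := by ring
  rw [IsTwoJump, e]
  constructor
  · linear_combination -(1 + s / 2) * h₁ + s / 2 * h₂
  · linear_combination -(1 - s / 2) * h₂ - s / 2 * h₁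

/-- Quantitative injectivity of the scalar flux: it bounds the change across a jump and singles out
the relevant root of the quadratic. -/
lemma three_mul_abs_sub_le {η b x y : ℝ} (h : 3 ≤ b - 2 * η * (x + y)) :
    3 * |x - y| ≤ |scalarFlux η b x - scalarFlux η b y| := by
  have e : scalarFlux η b x - scalarFlux η b y = -((b - 2 * η * (x + y)) * (x - y)) := by
    simp only [scalarFlux]; ring
  rw [e, abs_neg, abs_mul]
  gcongr
  exact h.trans (le_abs_self _)

lemma lt_of_scalarFlux_lt {η b x y : ℝ} (h : 0 ≤ b - 2 * η * (x + y))
    (hxy : scalarFlux η b y < scalarFlux η b x) : x < y := by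
  by_contra! hle
  have e : scalarFlux η b x - scalarFlux η b y = -((b - 2 * η * (x + y)) * (x - y)) := by
    simp only [scalarFlux]; ring
  nlinarith [mul_nonneg h (sub_nonneg.2 hle)]

/-- The root of `scalarFlux η b x = T` that stays bounded as `η → 0`. -/
noncomputable def scalarRoot (η b T : ℝ) : ℝ := -(2 * T) / (b + √(b ^ 2 + 8 * η * T))

lemma scalarFlux_scalarRoot {η b T : ℝ} (hb : 0 < b) (hd : 0 ≤ b ^ 2 + 8 * η * T) :
    scalarFlux η b (scalarRoot η b T) = T := by
  have hr := Real.sqrt_nonneg (b ^ 2 + 8 * η * T)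
  have hsq := Real.sq_sqrt hd
  rw [scalarFlux, scalarRoot]
  set r := √(b ^ 2 + 8 * η * T)
  have : b + r ≠ 0 := by positivity
  field_simp
  linear_combination -T * hsq

lemma abs_scalarRoot_le {η b T : ℝ} (hb : 0 < b) : |scalarRoot η b T| ≤ 2 * |T| / b := by
  rw [scalarRoot, abs_div, abs_neg, abs_mul, abs_two,
    abs_of_nonneg (add_nonneg hb.le (Real.sqrt_nonneg _))]
  gcongr
  linarith [Real.sqrt_nonneg (b ^ 2 + 8 * η * T)]

/-! ### Smallness bounds near the reference state -/

/-- The state with wave coordinates `(A, B, v)` is close to `(a, 0, -a)`, relative to `a`. -/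
structure Near (c a A B v : ℝ) : Prop where
  left : |A - a / 2| ≤ c * a
  right : |B - a / 2| ≤ c * a
  mid : |v| ≤ c * a

/-- The ranges of the parameters `a` and `η`. -/
structure SmallParams (a η : ℝ) : Prop where
  pos : 0 < a
  lt_half : a < 1 / 2
  nonneg : 0 ≤ η
  le : η ≤ 1 / 1000 * a

lemma Near.mono {c c' a A B v : ℝ} (ha : 0 ≤ a) (hc : c ≤ c') (h : Near c a A B v) :
    Near c' a A B v := by
  have : c * a ≤ c' * a := by gcongr
  exact ⟨h.1.trans this, h.2.trans this, h.3.trans this⟩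

lemma Near.norm_lt_one {a A B v : ℝ} (ha : 0 < a) (ha' : a < 1 / 2)
    (h : Near (1 / 50) a A B v) : ‖ofWaveCoords A B v‖ < 1 := by
  obtain ⟨h₁, h₂, h₃⟩ := h
  rw [abs_le] at h₁ h₂ h₃
  rw [norm_lt_one_iff, ofWaveCoords_zero, ofWaveCoords_one, ofWaveCoords_two]
  have hu : (A + B) ^ 2 ≤ (3 / 5) ^ 2 := sq_le_sq' (by linarith) (by linarith)
  have hv : v ^ 2 ≤ (1 / 10) ^ 2 := sq_le_sq' (by linarith) (by linarith)
  have hvu : |v * (A + B)| ≤ 1 / 10 * (3 / 5) := by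
    rw [abs_mul]
    exact mul_le_mul (abs_le.2 ⟨by linarith, by linarith⟩) (abs_le.2 ⟨by linarith, by linarith⟩)
      (abs_nonneg _) (by norm_num)
  rw [abs_le] at hvu
  have hw : (v * A + (v - 2) * B) ^ 2 ≤ (7 / 10) ^ 2 :=
    sq_le_sq' (by linarith) (by linarith)
  linarith

lemma abs_waveCoords_le {A B v : ℝ} (h : ‖ofWaveCoords A B v‖ < 1) : |A| ≤ 2 ∧ |B| ≤ 2 := by
  rw [norm_lt_one_iff, ofWaveCoords_zero, ofWaveCoords_one, ofWaveCoords_two] at h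
  have hu : |A + B| ≤ 1 := abs_le_one_iff_mul_self_le_one.2 (by nlinarith)
  have hv : |v| ≤ 1 := abs_le_one_iff_mul_self_le_one.2 (by nlinarith)
  have hw : |v * A + (v - 2) * B| ≤ 1 := abs_le_one_iff_mul_self_le_one.2 (by nlinarith)
  have hvu : |v * (A + B)| ≤ 1 * 1 := by
    rw [abs_mul]
    exact mul_le_mul hv hu (abs_nonneg _) zero_le_one
  rw [abs_le] at hu hvu hw
  constructor <;> rw [abs_le] <;> constructor <;> linarith

lemma SmallParams.abs_eta_mul_le {a η x : ℝ} (h : SmallParams a η) (hx : |x| ≤ 2) :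
    |η * x| ≤ 1 / 500 * a := by
  rw [abs_mul, abs_of_nonneg h.nonneg]
  have := mul_le_mul h.le hx (abs_nonneg x) (by linarith [h.pos])
  linarith

lemma Near.abs_le {a A B v : ℝ} (ha : 0 < a) (h : Near (1 / 50) a A B v) :
    |A| ≤ 13 / 25 * a ∧ |B| ≤ 13 / 25 * a := by
  obtain ⟨h₁, h₂, -⟩ := h
  rw [_root_.abs_le] at *
  rw [_root_.abs_le]
  constructor <;> constructor <;> linarith

lemma Near.isCharSpeeds {a η A B v : ℝ} (hp : SmallParams a η) (h : Near (1 / 50) a A B v) :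
    IsCharSpeeds η (ofWaveCoords A B v) (charSpeeds η A B v) := by
  have ha := hp.pos
  have ha' := hp.lt_half
  obtain ⟨hA, hB⟩ := h.abs_le ha
  have hηA := hp.abs_eta_mul_le (hA.trans (by linarith))
  have hηB := hp.abs_eta_mul_le (hB.trans (by linarith))
  have hv := h.mid
  rw [_root_.abs_le] at hηA hηB hv
  apply isCharSpeeds_ofWaveCoords <;> linarith

/-- The common source term of the two equations of a jump of the second family. -/
lemma abs_source_le {a η A B v s : ℝ} (hp : SmallParams a η) (h : Near (1 / 100) a A B v)
    (hs : |s| ≤ 1 / 500 * a) :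
    |scalarFlux η (4 - (2 * v + s)) B - scalarFlux η (4 + (2 * v + s)) A| ≤ a / 10 := by
  have ha := hp.pos
  have ha' := hp.lt_half
  obtain ⟨hA, hB⟩ := (h.mono ha.le (show (1 / 100 : ℝ) ≤ 1 / 50 by norm_num)).abs_le ha
  obtain ⟨h₁, h₂, h₃⟩ := h
  have hγ : |2 * v + s| ≤ 11 / 1000 := by
    rw [_root_.abs_le] at *
    constructor <;> linarith
  have hAB : |A + B| ≤ 26 / 25 * a := (abs_add_le _ _).trans (by linarith)
  have hγu : |(2 * v + s) * (A + B)| ≤ 11 / 1000 * (26 / 25 * a) := by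
    rw [abs_mul]
    exact mul_le_mul hγ hAB (abs_nonneg _) (by norm_num)
  have hBA : |B - A| ≤ 1 / 50 * a := by
    rw [_root_.abs_le] at *
    constructor <;> linarith
  have hη : |η * (A + B)| ≤ 1 / 500 * a := hp.abs_eta_mul_le (hAB.trans (by linarith))
  have hq : |η * (A + B) * (B - A)| ≤ 1 / 500 * a * (1 / 50) := by
    rw [abs_mul]
    exact mul_le_mul hη (hBA.trans (by linarith)) (abs_nonneg _) (by linarith)
  -- Every term carries a factor `B - A` or `2 * v + s`, both small because `A` and `B` are near `a
  -- / 2` and `v` is near `0`.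
  have e : scalarFlux η (4 - (2 * v + s)) B - scalarFlux η (4 + (2 * v + s)) A =
      2 * (η * (A + B) * (B - A)) - 4 * (B - A) + (2 * v + s) * (A + B) := by
    simp only [scalarFlux]; ring
  rw [e]
  rw [_root_.abs_le] at *
  constructor <;> linarith

lemma scalarFlux_slope_le {a η b x y : ℝ} (hp : SmallParams a η) (hb : 39 / 10 ≤ b) (hx : |x| ≤ 2)
    (hy : |y| ≤ 2) : 3 ≤ b - 2 * η * (x + y) := by
  have ha := hp.lt_half
  have h₁ := hp.abs_eta_mul_le hx
  have h₂ := hp.abs_eta_mul_le hy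
  rw [_root_.abs_le] at h₁ h₂
  linarith

/-- The coordinates change little across a jump of the second family. -/
lemma IsTwoJump.abs_sub_le {a η A B v s A' B' : ℝ} (hp : SmallParams a η)
    (h : Near (1 / 100) a A B v) (hs : |s| ≤ 1 / 500 * a) (hj : IsTwoJump η v s A B A' B')
    (hA' : |A'| ≤ 2) (hB' : |B'| ≤ 2) : |A' - A| ≤ |s| * (a / 60) ∧ |B' - B| ≤ |s| * (a / 60) := by
  have ha := hp.pos
  have ha' := hp.lt_half
  have hK := abs_source_le hp h hs
  obtain ⟨hA, hB⟩ := (h.mono ha.le (show (1 / 100 : ℝ) ≤ 1 / 50 by norm_num)).abs_le ha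
  have hv := h.mid
  have hγ : |2 * v + s| ≤ 1 / 10 := by
    rw [_root_.abs_le] at *
    constructor <;> linarith
  rw [_root_.abs_le] at hγ
  have h₁ := three_mul_abs_sub_le (scalarFlux_slope_le (b := 4 + (2 * v + s)) hp (by linarith) hA'
    (hA.trans (by linarith)))
  have h₂ := three_mul_abs_sub_le (scalarFlux_slope_le (b := 4 - (2 * v + s)) hp (by linarith) hB'
    (hB.trans (by linarith)))
  have e : ∀ K : ℝ, |K| ≤ a / 10 → |s / 2 * K| ≤ |s| / 2 * (a / 10) := fun K hK => by
    rw [abs_mul, abs_div, abs_two]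
    gcongr
  have hsK := e _ hK
  rw [show scalarFlux η (4 + (2 * v + s)) A' - scalarFlux η (4 + (2 * v + s)) A =
    s / 2 * (scalarFlux η (4 - (2 * v + s)) B - scalarFlux η (4 + (2 * v + s)) A) by
      rw [hj.1]; ring] at h₁
  rw [show scalarFlux η (4 - (2 * v + s)) B' - scalarFlux η (4 - (2 * v + s)) B =
    s / 2 * (scalarFlux η (4 - (2 * v + s)) B - scalarFlux η (4 + (2 * v + s)) A) by
      rw [hj.2]; ring] at h₂
  constructor <;> linarith

lemma IsTwoJump.near {a η A B v s A' B' c d : ℝ} (hp : SmallParams a η) (hc : c ≤ 1 / 100)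
    (hd : d ≤ 1 / 500) (h : Near c a A B v) (hs : |s| ≤ d * a) (hj : IsTwoJump η v s A B A' B')
    (hA' : |A'| ≤ 2) (hB' : |B'| ≤ 2) : Near (c + d) a A' B' (v + s) := by
  have ha := hp.pos
  have ha' := hp.lt_half
  have hs' : |s| ≤ 1 / 500 * a := hs.trans (by gcongr)
  obtain ⟨h₁, h₂⟩ := hj.abs_sub_le hp (h.mono ha.le hc) hs' hA' hB'
  have hsa : |s| * (a / 60) ≤ d * a := by nlinarith [abs_nonneg s]
  obtain ⟨hA, hB, hv⟩ := h
  refine ⟨?_, ?_, ?_⟩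
  · rw [show A' - a / 2 = (A' - A) + (A - a / 2) by ring]
    exact (abs_add_le _ _).trans (by linarith)
  · rw [show B' - a / 2 = (B' - B) + (B - a / 2) by ring]
    exact (abs_add_le _ _).trans (by linarith)
  · exact (abs_add_le _ _).trans (by linarith)

/-! ### Hugoniot curves of the three families -/

lemma continuousOn_ofWaveCoords {f g h : ℝ → ℝ} {S : Set ℝ} (hf : ContinuousOn f S)
    (hg : ContinuousOn g S) (hh : ContinuousOn h S) :
    ContinuousOn (fun t => ofWaveCoords (f t) (g t) (h t)) S := by
  refine (PiLp.continuous_toLp 2 _).comp_continuousOn (continuousOn_pi.2 fun i => ?_)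
  fin_cases i
  · exact hf.add hg
  · exact hh
  · exact (hh.mul hf).add ((hh.sub continuousOn_const).mul hg)

lemma continuousOn_scalarRoot {η : ℝ} {b T : ℝ → ℝ} {S : Set ℝ} (hb : ContinuousOn b S)
    (hT : ContinuousOn T S) (hpos : ∀ t ∈ S, 0 < b t) :
    ContinuousOn (fun t => scalarRoot η (b t) (T t)) S := by
  unfold scalarRoot
  refine ((continuousOn_const.mul hT).neg).div
    (hb.add ((hb.pow 2).add (continuousOn_const.mul hT)).sqrt) fun t ht => ?_
  have := hpos t ht
  positivity

/-- Solvability of the scalar equations in the range that matters here. -/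
lemma scalarRoot_spec {a η b T : ℝ} (hp : SmallParams a η) (hb : 39 / 10 ≤ b)
    (hT : |T| ≤ 3) : scalarFlux η b (scalarRoot η b T) = T ∧ |scalarRoot η b T| ≤ 2 := by
  have hb0 : 0 < b := by linarith
  constructor
  · apply scalarFlux_scalarRoot hb0
    have hη : η ≤ 1 / 1000 := hp.le.trans (by linarith [hp.lt_half])
    have := mul_le_mul hη hT (abs_nonneg _) (by norm_num)
    rw [← abs_of_nonneg hp.nonneg, ← abs_mul, _root_.abs_le] at this
    nlinarith
  · refine (abs_scalarRoot_le hb0).trans ?_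
    rw [div_le_iff₀ hb0]
    linarith

lemma abs_scalarFlux_le {a η b x : ℝ} (hp : SmallParams a η) (hb : 0 ≤ b) (hb' : b ≤ 41 / 10)
    (hx : |x| ≤ 13 / 25 * a) : |scalarFlux η b x| ≤ 2 := by
  have ha := hp.lt_half
  have hη := hp.abs_eta_mul_le (hx.trans (by linarith))
  have e : scalarFlux η b x = (2 * (η * x) - b) * x := by simp only [scalarFlux]; ring
  have h₁ : |2 * (η * x) - b| ≤ 5 := by
    rw [_root_.abs_le] at hη ⊢
    constructor <;> linarith
  rw [e, abs_mul]
  have := mul_le_mul h₁ hx (abs_nonneg _) (by norm_num)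
  linarith

lemma Near.exists_hugoniot_two {a η A B v s : ℝ} (hp : SmallParams a η)
    (h : Near (1 / 100) a A B v) (hs : |s| ≤ 1 / 500 * a) :
    ∃ A' B', |A'| ≤ 2 ∧ |B'| ≤ 2 ∧ IsTwoJump η v s A B A' B' ∧
      OnHugoniotCurve η 1 s (ofWaveCoords A B v) (ofWaveCoords A' B' (v + s)) := by
  have ha := hp.pos
  have ha' := hp.lt_half
  have h50 := h.mono ha.le (show (1 / 100 : ℝ) ≤ 1 / 50 by norm_num)
  obtain ⟨hA, hB⟩ := h50.abs_le ha
  have hv := h.mid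
  set T : ℝ → ℝ := fun t => (1 - t / 2) * scalarFlux η (4 + (2 * v + t)) A
      + t / 2 * scalarFlux η (4 - (2 * v + t)) B with hTdef
  set T' : ℝ → ℝ := fun t => (1 + t / 2) * scalarFlux η (4 - (2 * v + t)) B
      - t / 2 * scalarFlux η (4 + (2 * v + t)) A with hTdef'
  set f : ℝ → ℝ := fun t => scalarRoot η (4 + (2 * v + t)) (T t) with hf
  set g : ℝ → ℝ := fun t => scalarRoot η (4 - (2 * v + t)) (T' t) with hg
  have hγ : ∀ t : ℝ, |t| ≤ 1 / 500 * a → |2 * v + t| ≤ 1 / 10 := fun t ht => by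
    rw [_root_.abs_le] at *
    constructor <;> linarith
  have key : ∀ t : ℝ, |t| ≤ 1 / 500 * a →
      |f t| ≤ 2 ∧ |g t| ≤ 2 ∧ IsTwoJump η v t A B (f t) (g t) := by
    intro t ht
    have h₁ := hγ t ht
    rw [_root_.abs_le] at h₁
    have hP := abs_scalarFlux_le (b := 4 + (2 * v + t)) hp (by linarith) (by linarith) hA
    have hQ := abs_scalarFlux_le (b := 4 - (2 * v + t)) hp (by linarith) (by linarith) hB
    have ht' : |t / 2| ≤ 1 / 10 := by
      rw [abs_div, abs_two]
      linarith
    have hP' := mul_le_mul ht' hP (abs_nonneg _) (by norm_num)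
    have hQ' := mul_le_mul ht' hQ (abs_nonneg _) (by norm_num)
    rw [← abs_mul] at hP' hQ'
    have hT : |T t| ≤ 3 := by
      simp only [hTdef]
      rw [_root_.abs_le] at *
      constructor <;> linarith
    have hT' : |T' t| ≤ 3 := by
      simp only [hTdef']
      rw [_root_.abs_le] at *
      constructor <;> linarith
    obtain ⟨e₁, b₁⟩ := scalarRoot_spec (b := 4 + (2 * v + t)) hp (by linarith) hT
    obtain ⟨e₂, b₂⟩ := scalarRoot_spec (b := 4 - (2 * v + t)) hp (by linarith) hT'
    exact ⟨b₁, b₂, e₁, e₂⟩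
  have hmem : ∀ t ∈ Set.uIcc 0 s, |t| ≤ 1 / 500 * a := fun t ht => by
    have := Set.abs_sub_left_of_mem_uIcc ht
    simp only [sub_zero] at this
    exact this.trans hs
  obtain ⟨hf2, hg2, hj⟩ := key s hs
  refine ⟨f s, g s, hf2, hg2, hj, fun t => ofWaveCoords (f t) (g t) (v + t), fun t => 2 * v + t,
    ?_, by fun_prop, ?_, rfl, ⟨_, h50.isCharSpeeds hp, ?_⟩, fun t ht => ?_⟩
  · refine continuousOn_ofWaveCoords ?_ ?_ (by fun_prop)
    · refine continuousOn_scalarRoot (by fun_prop) ?_ fun t ht => ?_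
      · simp only [hTdef, scalarFlux]
        fun_prop
      · have := hγ t (hmem t ht)
        rw [_root_.abs_le] at this
        linarith
    · refine continuousOn_scalarRoot (by fun_prop) ?_ fun t ht => ?_
      · simp only [hTdef', scalarFlux]
        fun_prop
      · have := hγ t (hmem t ht)
        rw [_root_.abs_le] at this
        linarith
  -- A jump of size `0` does not move the coordinates, so the chosen roots start at `A` and `B`.
  · have h0 : |(0 : ℝ)| ≤ 1 / 500 * a := by
      rw [abs_zero]
      positivity
    obtain ⟨b₁, b₂, hj₀⟩ := key 0 h0
    obtain ⟨e₁, e₂⟩ := hj₀.abs_sub_le hp h h0 b₁ b₂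
    rw [abs_zero, zero_mul, abs_nonpos_iff, sub_eq_zero] at e₁ e₂
    simp only [e₁, e₂, add_zero]
  · simp [charSpeeds]
  · obtain ⟨b₁, b₂, hjt⟩ := key t (hmem t ht)
    refine ⟨?_, (rankineHugoniot_two_iff ..).2 hjt, rfl⟩
    exact ((hjt.near hp le_rfl le_rfl h (hmem t ht) b₁ b₂).mono ha.le (by norm_num)).norm_lt_one
      ha ha'

/-- The second flux component forces the speed, and the unit ball confines the coordinates to a
range where, for small parameters, the scalar fluxes are injective. Thus the estimates reach every
point admitted by the definition of the locus. -/
lemma OnHugoniotCurve.exists_isTwoJump {η A B v s : ℝ} {V : State} (hs : s ≠ 0)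
    (h : OnHugoniotCurve η 1 s (ofWaveCoords A B v) V) :
    ∃ A' B', V = ofWaveCoords A' B' (v + s) ∧ |A'| ≤ 2 ∧ |B'| ≤ 2 ∧
      IsTwoJump η v s A B A' B' := by
  obtain ⟨S, γ, -, -, -, rfl, -, hS⟩ := h
  obtain ⟨hn, hRH, hv⟩ := hS s Set.right_mem_uIcc
  have hγ := speed_eq_of_rankineHugoniot hs hRH hv
  have hV := eq_ofWaveCoords (S s)
  have hv' : S s 1 = v + s := hv
  set A' := (S s 2 - (S s 1 - 2) * S s 0) / 2
  set B' := (S s 1 * S s 0 - S s 2) / 2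
  rw [hv'] at hV
  rw [hV, hγ, ofWaveCoords_one, rankineHugoniot_two_iff] at hRH
  rw [hV] at hn
  exact ⟨A', B', hV, (abs_waveCoords_le hn).1, (abs_waveCoords_le hn).2, hRH⟩

lemma rankineHugoniot_one (η A B v A' : ℝ) :
    RankineHugoniot η (ofWaveCoords A B v) (ofWaveCoords A' B v)
      (-4 + 2 * η * (A + A')) := by
  rw [rankineHugoniot_iff]
  intro i
  fin_cases i <;> simp [flux] <;> ring

lemma rankineHugoniot_three (η A B v B' : ℝ) :
    RankineHugoniot η (ofWaveCoords A B v) (ofWaveCoords A B' v)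
      (4 - 2 * η * (B + B')) := by
  rw [rankineHugoniot_iff]
  intro i
  fin_cases i <;> simp [flux] <;> ring

lemma onHugoniotCurve_one {η A B v σ : ℝ}
    (hc : IsCharSpeeds η (ofWaveCoords A B v) (charSpeeds η A B v))
    (hn : ∀ t ∈ Set.uIcc 0 σ, ‖ofWaveCoords (A + t) B v‖ < 1) :
    OnHugoniotCurve η 0 σ (ofWaveCoords A B v) (ofWaveCoords (A + σ) B v) := by
  refine ⟨fun t => ofWaveCoords (A + t) B v, fun t => -4 + 2 * η * (A + (A + t)),
    continuousOn_ofWaveCoords (by fun_prop) (by fun_prop) (by fun_prop), by fun_prop,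
    by simp, rfl, ⟨_, hc, ?_⟩, fun t ht => ⟨hn t ht, rankineHugoniot_one .., ?_⟩⟩
  · simp [charSpeeds]
    ring
  · simp [paramCoord]
    ring

lemma onHugoniotCurve_three {η A B v τ : ℝ}
    (hc : IsCharSpeeds η (ofWaveCoords A B v) (charSpeeds η A B v))
    (hn : ∀ t ∈ Set.uIcc 0 τ, ‖ofWaveCoords A (B + t) v‖ < 1) :
    OnHugoniotCurve η 2 τ (ofWaveCoords A B v) (ofWaveCoords A (B + τ) v) := by
  refine ⟨fun t => ofWaveCoords A (B + t) v, fun t => 4 - 2 * η * (B + (B + t)),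
    continuousOn_ofWaveCoords (by fun_prop) (by fun_prop) (by fun_prop), by fun_prop,
    by simp, rfl, ⟨_, hc, ?_⟩, fun t ht => ⟨hn t ht, rankineHugoniot_three .., ?_⟩⟩
  · simp [charSpeeds]
    ring
  · simp [paramCoord]
    ring

/-! ### Interaction of two 2-shocks -/

/-- The equations for the difference quotients `X`, `Y` of the wave coordinates. -/
lemma IsTwoJump.slope_eq {η v s A B X Y : ℝ} (hs : s ≠ 0)
    (h : IsTwoJump η v s A B (A + s * X) (B + s * Y)) :
    X * (4 + (2 * v + s) - 4 * η * A - 2 * η * s * X) =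
        -(2 * η * (B ^ 2 - A ^ 2) + 4 * (A - B) + (2 * v + s) * (A + B)) / 2 ∧
      Y * (4 - (2 * v + s) - 4 * η * B - 2 * η * s * Y) =
        -(2 * η * (B ^ 2 - A ^ 2) + 4 * (A - B) + (2 * v + s) * (A + B)) / 2 := by
  obtain ⟨h₁, h₂⟩ := h
  simp only [scalarFlux] at h₁ h₂
  constructor <;> apply mul_right_cancel₀ hs
  · linear_combination -h₁
  · linear_combination -h₂

/-- Comparison of two difference quotients `X₀`, `X₂` of a scalar equation of slope `k`, where the
source has slope `-(A + B) / 2`. -/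
lemma slope_sub_bounds {a η k c m s₁ s₂ X₀ X₂ : ℝ} (hp : SmallParams a η)
    (hs₁ : s₁ < 0) (hs₂ : s₂ < 0) (hX₀ : |X₀| ≤ a / 60) (hX₂ : |X₂| ≤ a / 60)
    (hk : 39 / 10 ≤ k) (hk' : k ≤ 41 / 10) (hm : 9 / 10 * a ≤ m) (hm' : m ≤ 11 / 10 * a)
    (hc : |c| ≤ 1)
    (h : (X₂ - X₀) * k + c * (s₂ * X₂ + s₁ * X₀) - 2 * η * (s₂ * X₂ ^ 2 + s₁ * X₀ ^ 2) =
      -(s₁ + s₂) / 2 * m) :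
    -(s₁ + s₂) * (a / 12) ≤ X₂ - X₀ ∧ X₂ - X₀ ≤ -(s₁ + s₂) * (a / 5) := by
  have ha := hp.pos
  have ha' := hp.lt_half
  have hterm : ∀ s X : ℝ, s < 0 → |X| ≤ a / 60 →
      |c * (s * X) - 2 * η * (s * X ^ 2)| ≤ -s * (a / 50) := by
    intro s X hs hX
    have h₁ := hp.abs_eta_mul_le (hX.trans (by linarith))
    have h₂ : |c - 2 * (η * X)| ≤ 6 / 5 := by
      rw [_root_.abs_le] at *
      constructor <;> linarith
    rw [show c * (s * X) - 2 * η * (s * X ^ 2) = s * ((c - 2 * (η * X)) * X) by ring, abs_mul,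
      abs_of_neg hs, abs_mul]
    have := mul_le_mul h₂ hX (abs_nonneg _) (by norm_num)
    have hs' : 0 ≤ -s := by linarith
    gcongr
    linarith
  have h₀ := hterm s₁ X₀ hs₁ hX₀
  have h₂ := hterm s₂ X₂ hs₂ hX₂
  rw [_root_.abs_le] at h₀ h₂
  have hS : 0 < -(s₁ + s₂) := by linarith
  have hm₁ := mul_le_mul_of_nonneg_left hm hS.le
  have hm₂ := mul_le_mul_of_nonneg_left hm' hS.le
  have hSa : 0 < -(s₁ + s₂) * a := mul_pos hS ha
  -- The main term is `m / 2` with `m ≈ a`, and the quadratic terms cost at most `a / 50`, both per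
  -- unit of `-(s₁ + s₂)`.
  have hlow : -(s₁ + s₂) * (2 / 5 * a) ≤ (X₂ - X₀) * k := by linarith
  have hup : (X₂ - X₀) * k ≤ -(s₁ + s₂) * (3 / 5 * a) := by linarith
  have hk0 : 0 < k := by linarith
  constructor
  · refine le_of_mul_le_mul_right (le_trans ?_ hlow) hk0
    nlinarith
  · refine le_of_mul_le_mul_right (le_trans hup ?_) hk0
    nlinarith

/-- Sign and size of the defect `(s₁ + s₂) • U₁ - s₂ • U₀ - s₁ • U₂` of three states joined by two
consecutive jumps of the second family, in the wave coordinates of the last one. -/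
lemma two_jumps_defect {a η v s₁ s₂ A₀ B₀ A₁ B₁ A₂ B₂ : ℝ} (hp : SmallParams a η)
    (hs₁ : s₁ < 0) (hs₂ : s₂ < 0) (hs₁' : |s₁| ≤ 1 / 1000 * a) (hs₂' : |s₂| ≤ 1 / 1000 * a)
    (hA₀ : |A₀| ≤ 2) (hB₀ : |B₀| ≤ 2) (hA₂ : |A₂| ≤ 2) (hB₂ : |B₂| ≤ 2)
    (hn : Near (1 / 100) a A₁ B₁ (v + s₁))
    (hj₁ : IsTwoJump η v s₁ A₀ B₀ A₁ B₁) (hj₂ : IsTwoJump η (v + s₁) s₂ A₁ B₁ A₂ B₂) :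
    (s₁ + s₂) * (A₁ - s₂ / 2 * (A₁ + B₁)) - s₂ * (A₀ - (s₁ + s₂) / 2 * (A₀ + B₀)) - s₁ * A₂ < 0 ∧
    -(1 / 1000 * a) ≤
      (s₁ + s₂) * (A₁ - s₂ / 2 * (A₁ + B₁)) - s₂ * (A₀ - (s₁ + s₂) / 2 * (A₀ + B₀)) - s₁ * A₂ ∧
    (s₁ + s₂) * (B₁ + s₂ / 2 * (A₁ + B₁)) - s₂ * (B₀ + (s₁ + s₂) / 2 * (A₀ + B₀)) - s₁ * B₂
      < 0 := by
  have ha := hp.pos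
  have ha' := hp.lt_half
  -- Reversing the first jump bases both difference quotients at the middle state.
  have hj₀ := hj₁.symm
  obtain ⟨bX₀, bY₀⟩ := hj₀.abs_sub_le hp hn (by rw [abs_neg]; linarith) hA₀ hB₀
  obtain ⟨bX₂, bY₂⟩ := hj₂.abs_sub_le hp hn (by linarith) hA₂ hB₂
  have hquot : ∀ s x y : ℝ, s ≠ 0 → |x - y| ≤ |s| * (a / 60) →
      ∃ q, x = y + s * q ∧ |q| ≤ a / 60 := fun s x y hs h => by
    refine ⟨(x - y) / s, by field_simp; ring, ?_⟩
    rwa [abs_div, div_le_iff₀ (abs_pos.2 hs), mul_comm]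
  obtain ⟨X₀, rfl, cX₀⟩ := hquot _ _ _ (neg_ne_zero.2 hs₁.ne) bX₀
  obtain ⟨Y₀, rfl, cY₀⟩ := hquot _ _ _ (neg_ne_zero.2 hs₁.ne) bY₀
  obtain ⟨X₂, rfl, cX₂⟩ := hquot _ _ _ hs₂.ne bX₂
  obtain ⟨Y₂, rfl, cY₂⟩ := hquot _ _ _ hs₂.ne bY₂
  obtain ⟨eX₀, eY₀⟩ := hj₀.slope_eq (neg_ne_zero.2 hs₁.ne)
  obtain ⟨eX₂, eY₂⟩ := hj₂.slope_eq hs₂.ne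
  obtain ⟨hA₁, hB₁⟩ := (hn.mono ha.le (show (1 / 100 : ℝ) ≤ 1 / 50 by norm_num)).abs_le ha
  have hηA := hp.abs_eta_mul_le (hA₁.trans (by linarith))
  have hηB := hp.abs_eta_mul_le (hB₁.trans (by linarith))
  obtain ⟨nA, nB, nv⟩ := hn
  rw [_root_.abs_le] at hηA hηB nA nB nv
  obtain ⟨lX, uX⟩ := slope_sub_bounds (k := 4 + 2 * (v + s₁) - 4 * η * A₁) (c := 1)
    (m := A₁ + B₁) hp hs₁ hs₂ cX₀ cX₂ (by linarith) (by linarith) (by linarith) (by linarith)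
    (by norm_num) (by linear_combination eX₂ - eX₀)
  obtain ⟨lY, uY⟩ := slope_sub_bounds (k := 4 - 2 * (v + s₁) - 4 * η * B₁) (c := -1)
    (m := A₁ + B₁) hp hs₁ hs₂ cY₀ cY₂ (by linarith) (by linarith) (by linarith) (by linarith)
    (by norm_num) (by linear_combination eY₂ - eY₀)
  have hsum : ∀ s X Y : ℝ, s < 0 → |X| ≤ a / 60 → |Y| ≤ a / 60 →
      |s * (X + Y)| ≤ -s * (a / 30) := fun s X Y hs hX hY => by
    rw [abs_mul, abs_of_neg hs]
    have : 0 ≤ -s := by linarith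
    gcongr
    exact (abs_add_le _ _).trans (by linarith)
  have h₀ := hsum s₁ X₀ Y₀ hs₁ cX₀ cY₀
  have h₂ := hsum s₂ X₂ Y₂ hs₂ cX₂ cY₂
  rw [_root_.abs_le] at h₀ h₂
  set S := -(s₁ + s₂) with hS
  have hSpos : 0 < S := by linarith only [hS, hs₁, hs₂]
  -- `dx` and `dy` are the slope differences in the basis of the middle state; the extra terms come
  -- from changing the bases of the outer states. The terms `s₂ / 2 * (dx + dy)` below pass to the
  -- basis of the last state.
  obtain ⟨dx, hdx⟩ : ∃ dx, dx = X₂ - X₀ + (s₂ * (X₂ + Y₂) + s₁ * (X₀ + Y₀)) / 2 := ⟨_, rfl⟩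
  obtain ⟨dy, hdy⟩ : ∃ dy, dy = Y₂ - Y₀ - (s₂ * (X₂ + Y₂) + s₁ * (X₀ + Y₀)) / 2 := ⟨_, rfl⟩
  have hSa : 0 < S * a := mul_pos hSpos ha
  have hSe : S * a = -(s₁ * a) - s₂ * a := by rw [hS]; ring
  have ldx : S * a / 15 ≤ dx := by linarith only [lX, h₀.1, h₂.1, hdx, hSe]
  have udx : dx ≤ S * a / 4 := by linarith only [uX, h₀.2, h₂.2, hdx, hSe, hSa]
  have ldy : S * a / 15 ≤ dy := by linarith only [lY, h₀.2, h₂.2, hdy, hSe]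
  have udy : dy ≤ S * a / 4 := by linarith only [uY, h₀.1, h₂.1, hdy, hSe, hSa]
  rw [abs_of_neg hs₁] at hs₁'
  rw [abs_of_neg hs₂] at hs₂'
  have hss : 0 < s₁ * s₂ := mul_pos_of_neg_of_neg hs₁ hs₂
  have hss' : s₁ * s₂ ≤ 1 := by
    have := mul_le_mul (show -s₁ ≤ 1 by linarith only [hs₁', ha'])
      (show -s₂ ≤ 1 by linarith only [hs₂', ha']) (by linarith only [hs₂]) zero_le_one
    linarith only [this]
  have hsd : 0 ≤ -s₂ * (dx + dy) := mul_nonneg (by linarith only [hs₂])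
    (by linarith only [ldx, ldy, hSa])
  have hsd' : -s₂ * (dx + dy) ≤ 1 / 100 * (S * a / 2) :=
    mul_le_mul (by linarith only [hs₂', ha']) (by linarith only [udx, udy])
      (by linarith only [ldx, ldy, hSa]) (by norm_num)
  have eA : (s₁ + s₂) * (A₁ - s₂ / 2 * (A₁ + B₁))
      - s₂ * (A₁ + -s₁ * X₀ - (s₁ + s₂) / 2 * (A₁ + -s₁ * X₀ + (B₁ + -s₁ * Y₀)))
      - s₁ * (A₁ + s₂ * X₂) = -(s₁ * s₂ * (dx - s₂ / 2 * (dx + dy))) := by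
    rw [hdx, hdy]; ring
  have eB : (s₁ + s₂) * (B₁ + s₂ / 2 * (A₁ + B₁))
      - s₂ * (B₁ + -s₁ * Y₀ + (s₁ + s₂) / 2 * (A₁ + -s₁ * X₀ + (B₁ + -s₁ * Y₀)))
      - s₁ * (B₁ + s₂ * Y₂) = -(s₁ * s₂ * (dy + s₂ / 2 * (dx + dy))) := by
    rw [hdx, hdy]; ring
  have pA : 0 < dx - s₂ / 2 * (dx + dy) := by linarith only [ldx, hsd, hSa]
  have pB : 0 < dy + s₂ / 2 * (dx + dy) := by linarith only [ldy, hsd', hSa]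
  have hSle : S * a ≤ 1 / 1000 * a := by
    gcongr
    linarith only [hS, hs₁', hs₂', ha']
  have uA : dx - s₂ / 2 * (dx + dy) ≤ 1 / 1000 * a := by linarith only [udx, hsd', hSle, hSa]
  rw [eA, eB]
  refine ⟨neg_neg_of_pos (mul_pos hss pA), ?_, neg_neg_of_pos (mul_pos hss pB)⟩
  have := mul_le_mul hss' uA pA.le zero_le_one
  linarith only [this]

/-- Two consecutive jumps of the second family can be replaced by a jump of the first, a jump of
the second and a jump of the third family. -/
lemma exists_interaction {a η v s₁ s₂ A₀ B₀ A₁ B₁ A₂ B₂ : ℝ} (hp : SmallParams a η)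
    (hs₁ : s₁ < 0) (hs₂ : s₂ < 0) (hs₁' : |s₁| ≤ 1 / 1000 * a) (hs₂' : |s₂| ≤ 1 / 1000 * a)
    (hn₀ : Near (1 / 500) a A₀ B₀ v) (hA₁ : |A₁| ≤ 2) (hB₁ : |B₁| ≤ 2)
    (hA₂ : |A₂| ≤ 2) (hB₂ : |B₂| ≤ 2)
    (hj₁ : IsTwoJump η v s₁ A₀ B₀ A₁ B₁) (hj₂ : IsTwoJump η (v + s₁) s₂ A₁ B₁ A₂ B₂) :
    ∃ X Y, X ∈ Set.Ico (A₀ - 1 / 1000 * a) A₀ ∧ Y < B₂ ∧ |Y| ≤ 2 ∧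
      IsTwoJump η v (s₁ + s₂) X B₀ A₂ Y ∧
      OnHugoniotCurve η 1 (s₁ + s₂) (ofWaveCoords X B₀ v)
        (ofWaveCoords A₂ Y (v + (s₁ + s₂))) := by
  have ha := hp.pos
  have ha' := hp.lt_half
  have hn₁ := hj₁.near hp (by norm_num) (by norm_num) hn₀ hs₁' hA₁ hB₁
  obtain ⟨hA₀, hB₀⟩ := (hn₀.mono ha.le (show (1 / 500 : ℝ) ≤ 1 / 50 by norm_num)).abs_le ha
  obtain ⟨hDA, hDA', hDB⟩ := two_jumps_defect hp hs₁ hs₂ hs₁' hs₂' (hA₀.trans (by linarith))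
    (hB₀.trans (by linarith)) hA₂ hB₂ (hn₁.mono ha.le (by norm_num)) hj₁ hj₂
  obtain ⟨DA, hDAdef⟩ : ∃ D, D = (s₁ + s₂) * (A₁ - s₂ / 2 * (A₁ + B₁))
    - s₂ * (A₀ - (s₁ + s₂) / 2 * (A₀ + B₀)) - s₁ * A₂ := ⟨_, rfl⟩
  obtain ⟨DB, hDBdef⟩ : ∃ D, D = (s₁ + s₂) * (B₁ + s₂ / 2 * (A₁ + B₁))
    - s₂ * (B₀ + (s₁ + s₂) / 2 * (A₀ + B₀)) - s₁ * B₂ := ⟨_, rfl⟩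
  rw [← hDAdef] at hDA hDA'
  rw [← hDBdef] at hDB
  obtain ⟨s, hs⟩ : ∃ s, s = s₁ + s₂ := ⟨_, rfl⟩
  have hsneg : s < 0 := by linarith
  have hsabs : |s| ≤ 1 / 500 * a := by
    rw [hs]
    exact (abs_add_le _ _).trans (by linarith)
  -- The Rankine-Hugoniot residual of the direct jump is the defect: both jump speeds are rewritten
  -- relative to `2 * v + s`.
  have eA : (1 - s / 2) * scalarFlux η (4 + (2 * v + s)) A₀
      + s / 2 * scalarFlux η (4 - (2 * v + s)) B₀ - scalarFlux η (4 + (2 * v + s)) A₂ = DA := by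
    obtain ⟨h₁, h₂⟩ := hj₁
    obtain ⟨h₃, h₄⟩ := hj₂
    simp only [scalarFlux] at *
    rw [hDAdef, hs]
    linear_combination -h₃ - (1 - s₂ / 2) * h₁ - s₂ / 2 * h₂
  have eB : scalarFlux η (4 - (2 * v + s)) B₂ - ((1 + s / 2) * scalarFlux η (4 - (2 * v + s)) B₀
      - s / 2 * scalarFlux η (4 + (2 * v + s)) A₀) = DB := by
    obtain ⟨h₁, h₂⟩ := hj₁
    obtain ⟨h₃, h₄⟩ := hj₂
    simp only [scalarFlux] at *
    rw [hDBdef, hs]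
    linear_combination h₄ + (1 + s₂ / 2) * h₂ - s₂ / 2 * h₁
  rw [← hs]
  have hγ : |2 * v + s| ≤ 1 / 10 := by
    have := hn₀.mid
    rw [_root_.abs_le] at *
    constructor <;> linarith
  rw [_root_.abs_le] at hγ
  have hdiff : ∀ X, X ≤ A₀ → A₀ - 1 / 1000 * a ≤ X →
      3 * (A₀ - X) ≤
        scalarFlux η (4 + (2 * v + s)) X - scalarFlux η (4 + (2 * v + s)) A₀ := by
    intro X hX hX'
    have hslope : 3 ≤ 4 + (2 * v + s) - 2 * η * (X + A₀) := by
      refine scalarFlux_slope_le hp (by linarith) ?_ (hA₀.trans (by linarith))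
      rw [_root_.abs_le] at *
      constructor <;> linarith
    have e : scalarFlux η (4 + (2 * v + s)) X - scalarFlux η (4 + (2 * v + s)) A₀ =
        (4 + (2 * v + s) - 2 * η * (X + A₀)) * (A₀ - X) := by
      simp only [scalarFlux]; ring
    rw [e]
    have : 0 ≤ A₀ - X := by linarith
    gcongr
  -- The residual is negative at `A₀`; lowering `A₀` by `a / 1000` raises it by at least `3a /
  -- 1000`, more than the defect.
  obtain ⟨X, hXmem, hX⟩ : ∃ X ∈ Set.Icc (A₀ - 1 / 1000 * a) A₀,
      (1 - s / 2) * scalarFlux η (4 + (2 * v + s)) X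
      + s / 2 * scalarFlux η (4 - (2 * v + s)) B₀ - scalarFlux η (4 + (2 * v + s)) A₂ = 0 := by
    refine intermediate_value_Icc' (by linarith) (f := fun X =>
      (1 - s / 2) * scalarFlux η (4 + (2 * v + s)) X
      + s / 2 * scalarFlux η (4 - (2 * v + s)) B₀ - scalarFlux η (4 + (2 * v + s)) A₂)
      (by simp only [scalarFlux]; fun_prop) ⟨by rw [eA]; exact hDA.le, ?_⟩
    have := hdiff (A₀ - 1 / 1000 * a) (by linarith) le_rfl
    nlinarith
  have hXlt : X < A₀ := by
    refine lt_of_le_of_ne hXmem.2 fun h => ?_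
    rw [h, eA] at hX
    linarith
  have hnX : Near (3 / 1000) a X B₀ v := by
    obtain ⟨n₁, n₂, n₃⟩ := hn₀
    refine ⟨?_, n₂.trans (by linarith), n₃.trans (by linarith)⟩
    rw [_root_.abs_le] at *
    constructor <;> linarith [hXmem.1, hXmem.2]
  obtain ⟨A', Y, hA', hY, hj, hcurve⟩ :=
    (hnX.mono ha.le (by norm_num)).exists_hugoniot_two hp hsabs
  have hAA : A' = A₂ := by
    have h := three_mul_abs_sub_le (scalarFlux_slope_le (b := 4 + (2 * v + s)) hp (by linarith)
      hA' hA₂)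
    rw [show scalarFlux η (4 + (2 * v + s)) A' - scalarFlux η (4 + (2 * v + s)) A₂ = 0 by
      rw [hj.1]; linarith, abs_zero] at h
    exact sub_eq_zero.1 (abs_nonpos_iff.1 (by linarith))
  subst hAA
  refine ⟨X, Y, ⟨hXmem.1, hXlt⟩, ?_, hY, hj, hcurve⟩
  -- Both the negative defect in `B` and the lowering of `A₀` to `X` make the flux at `Y` exceed
  -- that at `B₂`.
  refine lt_of_scalarFlux_lt (η := η) (b := 4 - (2 * v + s)) (le_trans (by norm_num)
    (scalarFlux_slope_le hp (by linarith) hY hB₂)) ?_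
  rw [hj.2]
  nlinarith [hdiff X hXlt.le hXmem.1]

/-! ### Assembly of the wave pattern -/

lemma Near.of_norm_sub_le {a : ℝ} {U : State} (ha : 0 < a) (ha' : a < 1 / 2)
    (h : ‖U - !₂[a, 0, -a]‖ ≤ 1 / 1000 * a) :
    Near (1 / 500) a ((U 2 - (U 1 - 2) * U 0) / 2) ((U 1 * U 0 - U 2) / 2) (U 1) := by
  have hcoord : ∀ i, |(U - !₂[a, 0, -a]) i| ≤ 1 / 1000 * a := fun i =>
    (PiLp.norm_apply_le _ i).trans h
  have h₀ : |U 0 - a| ≤ 1 / 1000 * a := hcoord 0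
  have h₁ : |U 1| ≤ 1 / 1000 * a := by simpa using hcoord 1
  have h₂ : |U 2 + a| ≤ 1 / 1000 * a := by simpa using hcoord 2
  have hu : |U 0| ≤ 1 := by
    rw [_root_.abs_le] at *
    constructor <;> linarith
  have hvu : |U 1 * U 0| ≤ 1 / 1000 * a * 1 := by
    rw [abs_mul]
    exact mul_le_mul h₁ hu (abs_nonneg _) (by linarith)
  rw [_root_.abs_le] at *
  refine ⟨?_, ?_, ?_⟩ <;> rw [_root_.abs_le] <;> constructor <;> linarith

end BaitiJenssen

theorem lemmal :
    ∃ ε : ℝ, 0 < ε ∧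
      ∀ (a η s₁ s₂ : ℝ) (Uℓ : BaitiJenssen.State),
        0 < a → a < 1 / 2 →
        ‖Uℓ - !₂[a, 0, -a]‖ ≤ ε * a →
        0 ≤ η → η ≤ ε * a →
        s₁ ∈ Set.Ico (-(ε * a)) 0 → s₂ ∈ Set.Ico (-(ε * a)) 0 →
        (∃ Um Ur, BaitiJenssen.IsWaveFan η 1 s₁ Uℓ Um ∧ BaitiJenssen.IsWaveFan η 1 s₂ Um Ur) ∧
        ∀ Um Ur, BaitiJenssen.IsWaveFan η 1 s₁ Uℓ Um → BaitiJenssen.IsWaveFan η 1 s₂ Um Ur →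
          ∃ σ τ : ℝ, σ < 0 ∧ 0 < τ ∧
            ∃ U' U'',
              BaitiJenssen.IsWaveFan η 0 σ Uℓ U' ∧
              BaitiJenssen.IsWaveFan η 1 (s₁ + s₂) U' U'' ∧
              BaitiJenssen.IsWaveFan η 2 τ U'' Ur ∧
              BaitiJenssen.IsLaxShock η 0 Uℓ U' ∧
              BaitiJenssen.IsLaxShock η 1 U' U'' ∧
              BaitiJenssen.IsLaxShock η 2 U'' Ur := by
  open BaitiJenssen in
  refine ⟨1 / 1000, by norm_num, ?_⟩
  intro a η s₁ s₂ Uℓ ha ha' hU hη hη' hs₁ hs₂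
  have hp : SmallParams a η := ⟨ha, ha', hη, hη'⟩
  have hn₀ := Near.of_norm_sub_le ha ha' hU
  have hUeq := eq_ofWaveCoords Uℓ
  set A₀ := (Uℓ 2 - (Uℓ 1 - 2) * Uℓ 0) / 2
  set B₀ := (Uℓ 1 * Uℓ 0 - Uℓ 2) / 2
  set v := Uℓ 1
  rw [hUeq]
  have hshock : ∀ s : ℝ, s < 0 → ∀ U V : State,
      IsWaveFan η 1 s U V ↔ OnHugoniotCurve η 1 s U V := fun s hs U V => by
    simp [IsWaveFan, IsShockParam, hs]
  have hs₁' : |s₁| ≤ 1 / 1000 * a := abs_le.2 ⟨hs₁.1, by linarith [hs₁.2]⟩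
  have hs₂' : |s₂| ≤ 1 / 1000 * a := abs_le.2 ⟨hs₂.1, by linarith [hs₂.2]⟩
  constructor
  · obtain ⟨A₁, B₁, hA₁, hB₁, hj₁, hc₁⟩ :=
      (hn₀.mono ha.le (by norm_num)).exists_hugoniot_two hp (s := s₁) (by linarith)
    have hn₁ := hj₁.near hp (by norm_num) (by norm_num) hn₀ hs₁' hA₁ hB₁
    obtain ⟨A₂, B₂, -, -, -, hc₂⟩ :=
      (hn₁.mono ha.le (by norm_num)).exists_hugoniot_two hp (s := s₂) (by linarith)
    exact ⟨_, _, (hshock _ hs₁.2 _ _).2 hc₁, (hshock _ hs₂.2 _ _).2 hc₂⟩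
  · intro Um Ur h₁ h₂
    rw [hshock _ hs₁.2] at h₁
    rw [hshock _ hs₂.2] at h₂
    obtain ⟨A₁, B₁, rfl, hA₁, hB₁, hj₁⟩ := h₁.exists_isTwoJump hs₁.2.ne
    obtain ⟨A₂, B₂, rfl, hA₂, hB₂, hj₂⟩ := h₂.exists_isTwoJump hs₂.2.ne
    have hn₁ := hj₁.near hp (by norm_num) (by norm_num) hn₀ hs₁' hA₁ hB₁
    have hn₂ := hj₂.near hp (by norm_num) (by norm_num) hn₁ hs₂' hA₂ hB₂
    obtain ⟨X, Y, hX, hY, hY2, hj, hc⟩ := exists_interaction hp hs₁.2 hs₂.2 hs₁' hs₂' hn₀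
      hA₁ hB₁ hA₂ hB₂ hj₁ hj₂
    have hs : s₁ + s₂ < 0 := by linarith [hs₁.2, hs₂.2]
    have hseg : ∀ t, t ∈ Set.Icc (A₀ - 1 / 1000 * a) A₀ → Near (3 / 1000) a t B₀ v := by
      intro t ht
      obtain ⟨n₁, n₂, n₃⟩ := hn₀
      refine ⟨?_, n₂.trans (by linarith), n₃.trans (by linarith)⟩
      rw [_root_.abs_le] at *
      constructor <;> linarith [ht.1, ht.2]
    have hnX := hseg X (Set.Ico_subset_Icc_self hX)
    have hnY := hj.near hp (by norm_num) (d := 1 / 500) (by norm_num) hnX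
      ((abs_add_le _ _).trans (by linarith)) hA₂ hY2
    -- `U''` and `Ur` now visibly share their second component and the coordinate `A₂`, so a single
    -- 3-wave joins them.
    rw [add_assoc v] at hn₂ ⊢
    have up : ∀ {c A B w : ℝ}, Near c a A B w → c ≤ 1 / 50 → Near (1 / 50) a A B w :=
      fun h hc => h.mono ha.le hc
    have n₀ := up hn₀ (by norm_num)
    have n₂ := up hn₂ (by norm_num)
    have nX := up hnX (by norm_num)
    have nY := up hnY (by norm_num)
    refine ⟨X - A₀, B₂ - Y, by linarith [hX.2], by linarith, ofWaveCoords X B₀ v,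
      ofWaveCoords A₂ Y (v + (s₁ + s₂)), ?_, (hshock _ hs _ _).2 hc, ?_, ?_, ?_, ?_⟩
    · refine Or.inl ⟨by simp [IsShockParam, hX.2], ?_⟩
      have := onHugoniotCurve_one (σ := X - A₀) (n₀.isCharSpeeds hp) fun t ht => ?_
      · rwa [add_sub_cancel] at this
      · rw [Set.uIcc_of_ge (by linarith [hX.2])] at ht
        exact (up (hseg (A₀ + t) ⟨by linarith [ht.1, hX.1], by linarith [ht.2]⟩)
          (by norm_num)).norm_lt_one ha ha'
    · refine Or.inl ⟨by simp [IsShockParam, hY], ?_⟩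
      have := onHugoniotCurve_three (τ := B₂ - Y) (nY.isCharSpeeds hp) fun t ht => ?_
      · rwa [add_sub_cancel] at this
      · rw [Set.uIcc_of_le (by linarith)] at ht
        refine Near.norm_lt_one ha ha' ⟨nY.left, ?_, nY.mid⟩
        have h₁ := nY.right
        have h₂ := n₂.right
        rw [_root_.abs_le] at *
        constructor <;> linarith [ht.1, ht.2]
    -- The shock speed is the mean of `λ₁` at the two states, so Lax reduces to `η * X ≤ η * A₀`.
    · refine ⟨fun h => ?_, _, _, _, rankineHugoniot_one .., n₀.isCharSpeeds hp,
        nX.isCharSpeeds hp, ?_, ?_⟩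
      · have := congrArg (fun W : State => W 0) h
        simp only [ofWaveCoords_zero] at this
        linarith [hX.2]
      all_goals
        simp only [charSpeeds, Matrix.cons_val]
        nlinarith [mul_nonneg hη (sub_nonneg.2 hX.2.le)]
    · refine ⟨fun h => ?_, _, _, _, (rankineHugoniot_two_iff ..).2 hj, nX.isCharSpeeds hp,
        nY.isCharSpeeds hp, ?_, ?_⟩
      · have := congrArg (fun W : State => W 1) h
        simp only [ofWaveCoords_one] at this
        linarith
      all_goals
        simp only [charSpeeds, Matrix.cons_val]
        linarith
    · refine ⟨fun h => ?_, _, _, _, rankineHugoniot_three .., nY.isCharSpeeds hp,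
        n₂.isCharSpeeds hp, ?_, ?_⟩
      · have := congrArg (fun W : State => W 0) h
        simp only [ofWaveCoords_zero] at this
        linarith
      all_goals
        simp only [charSpeeds, Matrix.cons_val]
        nlinarith [mul_nonneg hη (sub_nonneg.2 hY.le)]
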